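/- There is an absolute constant $c>0$ such that the following holds for all integers $n\ge 2$ and $m\ge 0$. Call a family $Q$ of linear subspaces of $(\mathbb{F}_2)^n$ an ideal if it is downward closed, i.e. $A\in Q$ and $B\subseteq A$ imply $B\in Q$. Let $(Q_1,\dots,Q_m)$ be random ideals with an arbitrary joint distribution (not necessarily independent), and let $f:\{0,1\}^m\to(\mathbb{F}_2)^n\setminus\{0\}$ be a function. Suppose that for every nonzero linear subspace $A$ of $(\mathbb{F}_2)^n$, $$\Pr_{Q_1,\dots,Q_m}\bigl[\,f\bigl(1_{\{A\in Q_1\}},\dots,1_{\{A\in Q_m\}}\bigr)\in A\,\bigr]\ \ge\ \tfrac12,$$ where $1_{\{A\in Q_i\}}\in\{0,1\}$ equals $1$ exactly when $A\in Q_i$. Then $m\ge c\,n^2$. In other words, $m=\Omega(n^2)$. -/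

import Mathlib

/-- The vector space `(F_2)^n`. -/
abbrev F2Vec (n : ℕ) : Type := Fin n → ZMod 2

/-- The lattice of linear subspaces of `(F_2)^n`, ordered by inclusion. -/
abbrev SubspaceLattice (n : ℕ) : Type := Submodule (ZMod 2) (F2Vec n)

/-- Ideals of the subspace lattice in the sense of downward-closed sets of subspaces: `A ∈ Q` and
`B ≤ A` imply `B ∈ Q`. (Mathlib's `Order.Ideal` also demands closure under joins, which is not
meant here. The empty and the full family are allowed.) -/
abbrev SubspaceIdeal (n : ℕ) : Type := LowerSet (SubspaceLattice n)

open Classical in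
/-- The vector of answers `(1_{A ∈ Q_1}, …, 1_{A ∈ Q_m})` to the queries `Q_1, …, Q_m` on the
hidden subspace `A`. -/
noncomputable def queryAnswers {n m : ℕ} (Q : Fin m → SubspaceIdeal n) (A : SubspaceLattice n) :
    Fin m → Bool :=
  fun i => decide (A ∈ Q i)

/-- The probability, over `(Q_1, …, Q_m)` drawn from the joint distribution `P`, that the decoder
`f` returns a (nonzero) vector of the hidden subspace `A` from the answers. -/
noncomputable def successProb {n m : ℕ} (P : PMF (Fin m → SubspaceIdeal n))
    (f : (Fin m → Bool) → {v : F2Vec n // v ≠ 0}) (A : SubspaceLattice n) : ENNReal :=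
  P.toOuterMeasure {Q | (f (queryAnswers Q A) : F2Vec n) ∈ A}

/-!
The proof plays the decoder against a random subspace whose dimension `k` is itself spread over
`1, …, n / 2`. Two facts compete.

*Guessing a vector of a random `k`-dimensional subspace needs many bits.* A fixed nonzero vector lies
in such a subspace with probability at most `2 ^ k / 2 ^ n` (`levelDensity_mem_le`). Answer vectors
that can be encoded with `n / 4` bits number at most `2 ^ (n / 4)`, and together they yield a success
probability of at most `2 ^ (n / 4 + k - n) ≤ 2 ^ (-n / 4)`. So for each `k ≤ n / 2` the answers must
have expected code length of order `n` (`levelDensity_success_le`).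

*A query yields `O(1)` bits over all dimensions together.* Let `p k` be the probability that a random
`k`-dimensional subspace lies in a fixed ideal. Then the odds `p k / (1 - p k)` at least halve when
`k` grows by one (`levelDensity_succ_odds_le`), so `p k` drops from near `1` to near `0` around a
threshold, with an error that is exponentially small in the distance to it (`exists_threshold`).
Charging `2 ^ (-j)` for the expected answer and `j + 1` for the unexpected one, at distance `j` from
the threshold, satisfies Kraft's inequality (`sum_half_rpow_answerCost_le_one`), and the expected cost,
summed over all `k`, is at most `12` (`sum_thresholdDist_le`).

Together the `m` queries pay at most `12 m` bits, while about `n / 2` dimensions demand order `n` bits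
each; hence `m` is of order `n ^ 2`.

The halving of the odds is a spectral gap. On a finite modular lattice, the operators that sum a
function over lower covers and over upper covers are adjoint, and their two compositions differ by a
diagonal operator (`sum_lowerCoverSum_sq`), because two distinct elements have a common upper cover
exactly when they have a common lower cover. Induction on the dimension then bounds the operator on
functions of mean zero on a level: it scales their squared norms by at most half of the factor for
constants (`sum_lowerCoverSum_sq_le`). Testing this on the centred indicator of an ideal gives the
inequality for the odds.
-/

open Finset Module
open scoped Classical

/-! ### Summation over covers in a modular lattice -/

section ModularLattice

variable {L : Type*} [Lattice L] [Fintype L]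

/-- The sum of `f` over the lower covers of `A`. -/
noncomputable def lowerCoverSum (f : L → ℝ) (A : L) : ℝ := ∑ B with B ⋖ A, f B

/-- The sum of `f` over the upper covers of `B`. -/
noncomputable def upperCoverSum (f : L → ℝ) (B : L) : ℝ := ∑ A with B ⋖ A, f A

/-- Summation over lower covers and summation over upper covers are adjoint. -/
theorem sum_lowerCoverSum_mul (f g : L → ℝ) :
    ∑ A, lowerCoverSum f A * g A = ∑ B, f B * upperCoverSum g B := by
  simp only [lowerCoverSum, upperCoverSum, sum_mul, mul_sum, sum_filter]
  rw [sum_comm]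
  simp

/-- The only candidate for a common upper cover is the join, the only one for a common lower cover is
the meet, and modularity makes them covers simultaneously. -/
theorem card_common_covers_eq [IsModularLattice L] {B B' : L} (h : B ≠ B') :
    #{A | B ⋖ A ∧ B' ⋖ A} = #{C | C ⋖ B ∧ C ⋖ B'} := by
  have key : ∀ {X Y : L}, X ≠ Y → ∀ {A : L}, X ⋖ A → Y ⋖ A → A = X ⊔ Y := by
    intro X Y hne A hX hY
    refine (hX.eq_or_eq le_sup_left (sup_le hX.le hY.le)).elim (fun h => ?_) Eq.symm
    exact (hne ((hY.eq_or_eq (sup_eq_left.1 h) hX.le).elim id fun h' => (hX.ne h').elim)).elim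
  have key' : ∀ {X Y : L}, X ≠ Y → ∀ {A : L}, A ⋖ X → A ⋖ Y → A = X ⊓ Y := by
    intro X Y hne A hX hY
    refine (hX.eq_or_eq (le_inf hX.le hY.le) inf_le_left).elim Eq.symm fun h => ?_
    exact (hne ((hY.eq_or_eq hX.le (inf_eq_left.1 h)).elim (fun h' => (hX.ne h'.symm).elim)
      id)).elim
  by_cases hc : B ⋖ B ⊔ B' ∧ B' ⋖ B ⊔ B'
  · have hd : B ⊓ B' ⋖ B ∧ B ⊓ B' ⋖ B' :=
      ⟨inf_covBy_of_covBy_sup_right hc.2, inf_covBy_of_covBy_sup_left hc.1⟩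
    have h1 : ({A | B ⋖ A ∧ B' ⋖ A} : Finset L) = {B ⊔ B'} := by
      ext A
      simp only [mem_filter, mem_univ, true_and, mem_singleton]
      exact ⟨fun hA => key h hA.1 hA.2, fun hA => hA ▸ hc⟩
    have h2 : ({C | C ⋖ B ∧ C ⋖ B'} : Finset L) = {B ⊓ B'} := by
      ext A
      simp only [mem_filter, mem_univ, true_and, mem_singleton]
      exact ⟨fun hA => key' h hA.1 hA.2, fun hA => hA ▸ hd⟩
    rw [h1, h2, card_singleton, card_singleton]
  · rw [filter_false_of_mem, filter_false_of_mem]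
    · rintro C - ⟨h1, h2⟩
      have := key' h h1 h2
      subst this
      exact hc ⟨covBy_sup_of_inf_covBy_right h2, covBy_sup_of_inf_covBy_left h1⟩
    · rintro A - ⟨h1, h2⟩
      have := key h h1 h2
      subst this
      exact hc ⟨h1, h2⟩

/-- The two compositions of summation over lower and over upper covers differ by a diagonal operator,
as off the diagonal the common upper and the common lower covers are equally many. -/
theorem sum_lowerCoverSum_sq [IsModularLattice L] (f : L → ℝ) :
    ∑ A, lowerCoverSum f A ^ 2 = ∑ C, upperCoverSum f C ^ 2 +
      ∑ B, ((#{A | B ⋖ A} : ℝ) - #{C | C ⋖ B}) * f B ^ 2 := by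
  have expand : ∀ r : L → L → Prop, ∑ A, (∑ B with r B A, f B) ^ 2 =
      ∑ B, ∑ B', (#{A | r B A ∧ r B' A} : ℝ) * (f B * f B') := by
    intro r
    simp only [sq, sum_filter, sum_mul_sum]
    simp only [card_filter, Nat.cast_sum, sum_mul]
    rw [sum_comm]
    refine sum_congr rfl fun B _ => ?_
    rw [sum_comm]
    refine sum_congr rfl fun B' _ => sum_congr rfl fun A _ => ?_
    by_cases h1 : r B A <;> by_cases h2 : r B' A <;> simp [h1, h2]
  have h1 : ∑ A, lowerCoverSum f A ^ 2 = _ := expand fun B A => B ⋖ A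
  have h2 : ∑ C, upperCoverSum f C ^ 2 = _ := expand fun B C => C ⋖ B
  rw [h1, h2, ← sum_add_distrib]
  refine sum_congr rfl fun B _ => ?_
  rw [← sub_eq_iff_eq_add', ← sum_sub_distrib, sum_eq_single B]
  · simp only [and_self]
    ring
  · intro B' _ hB'
    rw [card_common_covers_eq hB'.symm, sub_self]
  · simp

end ModularLattice

/-! ### Covers in the lattice of subspaces over the field with two elements -/

section Counting

variable {V : Type*} [AddCommGroup V] [Module (ZMod 2) V]

theorem Submodule.covBy_iff_finrank [Finite V] {B A : Submodule (ZMod 2) V} :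
    B ⋖ A ↔ B ≤ A ∧ finrank (ZMod 2) A = finrank (ZMod 2) B + 1 := by
  constructor
  · intro h
    obtain ⟨v, hv, hvB⟩ := SetLike.exists_of_lt h.lt
    have hle : B ⊔ (ZMod 2) ∙ v ≤ A := sup_le h.le (by simpa using hv)
    have hA : B ⊔ (ZMod 2) ∙ v = A :=
      (h.eq_or_eq le_sup_left hle).elim (fun h' => (hvB (by simpa using h')).elim) id
    exact ⟨h.le, hA ▸ Submodule.finrank_sup_span_singleton hvB⟩
  · rintro ⟨hle, hA⟩
    refine ⟨lt_of_le_of_ne hle (by rintro rfl; omega), fun C hBC hCA => ?_⟩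
    have h1 := Submodule.finrank_lt_finrank_of_lt hBC
    have h2 := Submodule.finrank_lt_finrank_of_lt hCA
    omega

theorem Submodule.sup_span_singleton_eq_iff_of_covBy [Finite V] {B A : Submodule (ZMod 2) V}
    (h : B ⋖ A) {v : V} (hv : v ∉ B) : B ⊔ (ZMod 2) ∙ v = A ↔ v ∈ A := by
  constructor
  · rintro rfl
    exact Submodule.mem_sup_right (Submodule.mem_span_singleton_self v)
  · intro hvA
    exact (h.eq_or_eq le_sup_left (sup_le h.le (by simpa using hvA))).elim
      (fun h' => (hv (by simpa using h')).elim) id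

theorem Submodule.card_mem_eq_two_pow [Fintype V] (A : Submodule (ZMod 2) V) :
    #{v | v ∈ A} = 2 ^ finrank (ZMod 2) A := by
  rw [← Fintype.card_subtype, Module.card_eq_pow_finrank (K := ZMod 2) (V := A), ZMod.card]

/-- The upper covers `A` of `B` partition the complement of `B` into sets `A \ B` of size `2 ^ dim B`,
since `v ∉ B` lies in the single cover spanned by `B` and `v`. -/
theorem Submodule.card_upper_covers [Fintype V] [Fintype (Submodule (ZMod 2) V)]
    (B : Submodule (ZMod 2) V) :
    #{A | B ⋖ A} + 1 = 2 ^ (finrank (ZMod 2) V - finrank (ZMod 2) B) := by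
  set k := finrank (ZMod 2) B with hk
  have hkn : k ≤ finrank (ZMod 2) V := Submodule.finrank_le B
  have hdiff : ∀ A : Submodule (ZMod 2) V, B ≤ A →
      #{v | v ∈ A ∧ v ∉ B} + 2 ^ k = 2 ^ finrank (ZMod 2) A := by
    intro A hBA
    rw [← Submodule.card_mem_eq_two_pow A, hk, ← Submodule.card_mem_eq_two_pow B,
      ← card_union_of_disjoint]
    · congr 1
      ext v
      have := @hBA v
      simp only [mem_union, mem_filter, mem_univ, true_and]
      tauto
    · rw [disjoint_left]
      simp +contextual
  have hfib := card_eq_sum_card_fiberwise (s := ({v | v ∉ B} : Finset V))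
    (t := ({A | B ⋖ A} : Finset (Submodule (ZMod 2) V))) (f := fun v => B ⊔ (ZMod 2) ∙ v)
    (by
      intro v hv
      have hv' : v ∉ B := by simpa using hv
      simpa [sup_comm] using covBy_span_singleton_sup hv')
  have hcard : ∀ A ∈ ({A | B ⋖ A} : Finset (Submodule (ZMod 2) V)),
      #{v ∈ ({v | v ∉ B} : Finset V) | B ⊔ (ZMod 2) ∙ v = A} = 2 ^ k := by
    intro A hA
    have hA' : B ⋖ A := by simpa using hA
    have h1 := hdiff A hA'.le
    rw [(Submodule.covBy_iff_finrank.1 hA').2, pow_succ] at h1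
    have h2 : #{v ∈ ({v | v ∉ B} : Finset V) | B ⊔ (ZMod 2) ∙ v = A} =
        #{v | v ∈ A ∧ v ∉ B} := by
      rw [filter_filter]
      congr 1
      ext v
      simp only [mem_filter, mem_univ, true_and]
      rw [and_comm]
      exact and_congr_left fun hv => Submodule.sup_span_singleton_eq_iff_of_covBy hA' hv
    have h3 : #{v ∈ ({v | v ∉ B} : Finset V) | B ⊔ (ZMod 2) ∙ v = A} + 2 ^ k = 2 ^ k * 2 := by
      rw [h2, ← h1]
    omega
  rw [sum_congr rfl hcard, sum_const, smul_eq_mul] at hfib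
  have htop := hdiff ⊤ le_top
  simp only [Submodule.mem_top, true_and, finrank_top] at htop
  have hpos : 0 < 2 ^ k := by positivity
  refine Nat.eq_of_mul_eq_mul_right hpos ?_
  rw [← pow_add, Nat.sub_add_cancel hkn, add_mul, ← hfib, one_mul]
  exact htop

/-- Passing to annihilators turns lower covers into upper covers in the dual space. -/
theorem Submodule.card_lower_covers [Fintype V] [Fintype (Submodule (ZMod 2) V)]
    (A : Submodule (ZMod 2) V) :
    #{B | B ⋖ A} + 1 = 2 ^ finrank (ZMod 2) A := by
  have : Finite (Dual (ZMod 2) V) := Finite.of_injective _ DFunLike.coe_injective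
  have := Fintype.ofFinite (Dual (ZMod 2) V)
  have := Fintype.ofFinite (Submodule (ZMod 2) (Dual (ZMod 2) V))
  let e := Subspace.orderIsoFiniteDimensional (K := ZMod 2) (V := V)
  have h1 := Submodule.card_upper_covers A.dualAnnihilator
  have h2 : finrank (ZMod 2) (Dual (ZMod 2) V) - finrank (ZMod 2) A.dualAnnihilator =
      finrank (ZMod 2) A := by
    have := Subspace.finrank_add_finrank_dualAnnihilator_eq A
    rw [Subspace.dual_finrank_eq]
    omega
  have he : ∀ B, OrderDual.ofDual (e B) = B.dualAnnihilator := fun _ => rfl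
  rw [← h2, ← h1]
  congr 1
  refine card_bij (fun B _ => OrderDual.ofDual (e B)) ?_ ?_ ?_
  · intro B hB
    have hB' : B ⋖ A := by simpa using hB
    have := (apply_covBy_apply_iff e).2 hB'
    simpa [he] using this.ofDual
  · intro B _ B' _ h
    exact e.injective h
  · intro C hC
    have hC' : A.dualAnnihilator ⋖ C := by simpa using hC
    refine ⟨e.symm (OrderDual.toDual C), ?_, by simp⟩
    have : OrderDual.toDual C ⋖ e A := hC'.toDual
    simp only [mem_filter, mem_univ, true_and]
    rw [← apply_covBy_apply_iff e]
    simpa using this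

end Counting

/-! ### The spectral gap between consecutive levels -/

section SpectralGap

variable {V : Type*} [AddCommGroup V] [Module (ZMod 2) V] [Fintype V]
  [Fintype (Submodule (ZMod 2) V)]

theorem Submodule.card_upper_covers_real (B : Submodule (ZMod 2) V) :
    (#{A | B ⋖ A} : ℝ) = 2 ^ (finrank (ZMod 2) V - finrank (ZMod 2) B) - 1 := by
  rw [eq_sub_iff_add_eq]
  exact_mod_cast Submodule.card_upper_covers B

theorem Submodule.card_lower_covers_real (A : Submodule (ZMod 2) V) :
    (#{B | B ⋖ A} : ℝ) = 2 ^ finrank (ZMod 2) A - 1 := by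
  rw [eq_sub_iff_add_eq]
  exact_mod_cast Submodule.card_lower_covers A

/-- A bound for one of two mutually adjoint operators bounds the other: if summation over lower
covers expands squared norms by at most `μ` on the image of `f`, so does summation over upper covers
at `f`. -/
theorem sum_upperCoverSum_sq_le {L : Type*} [Lattice L] [Fintype L] {f : L → ℝ} {μ : ℝ}
    (hμ : 0 ≤ μ)
    (h : ∑ A, lowerCoverSum (upperCoverSum f) A ^ 2 ≤ μ * ∑ C, upperCoverSum f C ^ 2) :
    ∑ C, upperCoverSum f C ^ 2 ≤ μ * ∑ A, f A ^ 2 := by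
  set X := ∑ C, upperCoverSum f C ^ 2 with hX
  have hX' : X = ∑ A, lowerCoverSum (upperCoverSum f) A * f A := by
    rw [sum_lowerCoverSum_mul, hX]
    simp only [sq]
  have hcs := sum_mul_sq_le_sq_mul_sq univ (lowerCoverSum (upperCoverSum f)) f
  rw [← hX'] at hcs
  have hS : 0 ≤ ∑ A, f A ^ 2 := sum_nonneg fun _ _ => sq_nonneg _
  have hX0 : 0 ≤ X := sum_nonneg fun _ _ => sq_nonneg _
  rcases hX0.eq_or_lt with h0 | hpos
  · rw [← h0]
    exact mul_nonneg hμ hS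
  · have : X * X ≤ X * (μ * ∑ A, f A ^ 2) := by
      calc X * X = X ^ 2 := (sq X).symm
        _ ≤ _ := hcs
        _ ≤ (μ * X) * ∑ A, f A ^ 2 := mul_le_mul_of_nonneg_right h hS
        _ = _ := by ring
    exact le_of_mul_le_mul_left this hpos

/-- The spectral gap: on functions of mean zero on level `k` of a space of dimension `k + d + 1`,
summation over lower covers multiplies the squared norm by at most
`(2 ^ (d + 1) - 2) * (2 ^ k - 1)`. On constants the factor is `(2 ^ (d + 1) - 1) * (2 ^ (k + 1) - 1)`,
more than twice as large. -/
theorem sum_lowerCoverSum_sq_le (d : ℕ) : ∀ (k : ℕ), k + d + 1 = finrank (ZMod 2) V →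
    ∀ f : Submodule (ZMod 2) V → ℝ, (∀ A : Submodule (ZMod 2) V, finrank (ZMod 2) A ≠ k → f A = 0) →
    ∑ A, f A = 0 →
    ∑ A, lowerCoverSum f A ^ 2 ≤ (2 ^ (d + 1) - 2) * (2 ^ k - 1) * ∑ A, f A ^ 2 := by
  intro k
  induction k generalizing d with
  | zero =>
    intro _ f hf h0
    have hbot : ∀ A : Submodule (ZMod 2) V, A ≠ ⊥ → f A = 0 := fun A hA => hf A (by simpa using hA)
    have hfz : f = 0 := by
      ext A
      by_cases hA : A = ⊥
      · subst hA
        rwa [sum_eq_single ⊥ (fun A _ => hbot A) (by simp)] at h0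
      · exact hbot A hA
    simp [hfz, lowerCoverSum]
  | succ k ih =>
    intro hn f hf h0
    have hsupp : ∀ C : Submodule (ZMod 2) V, finrank (ZMod 2) C ≠ k → upperCoverSum f C = 0 := by
      intro C hC
      refine sum_eq_zero fun A hA => hf A ?_
      rw [(Submodule.covBy_iff_finrank.1 (by simpa using hA)).2]
      omega
    have hsum : ∑ C, upperCoverSum f C = 0 := by
      have h1 := sum_lowerCoverSum_mul (fun _ => 1) f
      simp only [one_mul] at h1
      rw [← h1, ← mul_zero ((2 : ℝ) ^ (k + 1) - 1), ← h0, mul_sum]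
      refine sum_congr rfl fun A _ => ?_
      by_cases hA : finrank (ZMod 2) A = k + 1
      · simp [lowerCoverSum, Submodule.card_lower_covers_real, hA]
      · simp [hf A hA]
    have hμ : (0 : ℝ) ≤ (2 ^ (d + 1 + 1) - 2) * (2 ^ k - 1) := by
      have h1 : (1 : ℝ) ≤ 2 ^ (d + 1) := one_le_pow₀ one_le_two
      have h2 : (1 : ℝ) ≤ 2 ^ k := one_le_pow₀ one_le_two
      rw [pow_succ 2 (d + 1)]
      exact mul_nonneg (by linarith) (by linarith)
    -- the induction hypothesis applies to the sum over upper covers, which lives one level below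
    have h1 := sum_upperCoverSum_sq_le hμ (ih (d + 1) (by omega) _ hsupp hsum)
    rw [sum_lowerCoverSum_sq]
    have h2 : ∑ B, ((#{A | B ⋖ A} : ℝ) - #{C | C ⋖ B}) * f B ^ 2 =
        ((2 ^ (d + 1) - 1) - (2 ^ (k + 1) - 1)) * ∑ B, f B ^ 2 := by
      rw [mul_sum]
      refine sum_congr rfl fun B _ => ?_
      by_cases hB : finrank (ZMod 2) B = k + 1
      · rw [Submodule.card_lower_covers_real, Submodule.card_upper_covers_real, hB, ← hn]
        congr 5
        omega
      · simp [hf B hB]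
    rw [h2]
    calc _ ≤ _ := add_le_add_left h1 _
      _ = _ := by ring

end SpectralGap

/-! ### Densities on levels -/

section Level

variable {V : Type*} [AddCommGroup V] [Module (ZMod 2) V] [Fintype (Submodule (ZMod 2) V)]

/-- The set of subspaces of dimension `k`. -/
noncomputable def level (V : Type*) [AddCommGroup V] [Module (ZMod 2) V]
    [Fintype (Submodule (ZMod 2) V)] (k : ℕ) : Finset (Submodule (ZMod 2) V) :=
  {A | finrank (ZMod 2) A = k}

/-- The fraction of the subspaces of dimension `k` that belong to `S`. -/
noncomputable def levelDensity (S : Set (Submodule (ZMod 2) V)) (k : ℕ) : ℝ :=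
  #{A ∈ level V k | A ∈ S} / #(level V k)

@[simp] theorem mem_level {k : ℕ} {A : Submodule (ZMod 2) V} :
    A ∈ level V k ↔ finrank (ZMod 2) A = k := by
  simp [level]

theorem levelDensity_nonneg (S : Set (Submodule (ZMod 2) V)) (k : ℕ) : 0 ≤ levelDensity S k := by
  unfold levelDensity
  positivity

theorem levelDensity_le_one (S : Set (Submodule (ZMod 2) V)) (k : ℕ) : levelDensity S k ≤ 1 :=
  div_le_one_of_le₀ (by exact_mod_cast card_filter_le _ _) (by positivity)

variable [Fintype V]

/-- Double counting of the covers between two consecutive levels, with a weight on the upper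
level. -/
theorem mul_sum_level_succ (g : Submodule (ZMod 2) V → ℝ) (k : ℕ) :
    (2 ^ (k + 1) - 1) * ∑ A ∈ level V (k + 1), g A = ∑ B ∈ level V k, upperCoverSum g B := by
  have h := sum_lowerCoverSum_mul (fun B => if B ∈ level V k then 1 else 0) g
  simp only [ite_mul, one_mul, zero_mul, sum_ite_mem, univ_inter] at h
  rw [← h, mul_sum]
  have hlow : ∀ A, lowerCoverSum (fun B => if B ∈ level V k then 1 else 0) A =
      if A ∈ level V (k + 1) then 2 ^ (k + 1) - 1 else 0 := by
    intro A
    have : ∀ B ∈ ({B | B ⋖ A} : Finset (Submodule (ZMod 2) V)),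
        (if B ∈ level V k then 1 else 0) = (if A ∈ level V (k + 1) then (1 : ℝ) else 0) := by
      intro B hB
      have hB' : B ⋖ A := by simpa using hB
      simp [(Submodule.covBy_iff_finrank.1 hB').2]
    rw [lowerCoverSum, sum_congr rfl this, sum_const, nsmul_eq_mul,
      Submodule.card_lower_covers_real]
    by_cases hA : A ∈ level V (k + 1)
    · rw [if_pos hA, if_pos hA, mem_level.1 hA, mul_one]
    · rw [if_neg hA, if_neg hA, mul_zero]
  simp only [hlow, ite_mul, zero_mul, sum_ite_mem, univ_inter]

theorem card_level_succ_mul (k : ℕ) :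
    (2 ^ (k + 1) - 1) * (#(level V (k + 1)) : ℝ) =
      (2 ^ (finrank (ZMod 2) V - k) - 1) * #(level V k) := by
  have h := mul_sum_level_succ (V := V) (fun _ => 1) k
  rw [sum_const, nsmul_one] at h
  rw [h, mul_comm, ← nsmul_eq_mul]
  refine sum_eq_card_nsmul fun B hB => ?_
  rw [mem_level] at hB
  simp [upperCoverSum, Submodule.card_upper_covers_real, hB]

theorem card_level_pos : ∀ {k : ℕ}, k ≤ finrank (ZMod 2) V → (0 : ℝ) < #(level V k)
  | 0, _ => by
    rw [Nat.cast_pos, card_pos]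
    exact ⟨⊥, by simp⟩
  | k + 1, hk => by
    have h := card_level_succ_mul (V := V) k
    have h1 : (0 : ℝ) < 2 ^ (k + 1) - 1 := sub_pos.2 (one_lt_pow₀ one_lt_two (by omega))
    have h2 : (0 : ℝ) < 2 ^ (finrank (ZMod 2) V - k) - 1 :=
      sub_pos.2 (one_lt_pow₀ one_lt_two (by omega))
    have h3 := mul_pos h2 (card_level_pos (show k ≤ finrank (ZMod 2) V by omega))
    rw [← h] at h3
    exact pos_of_mul_pos_right h3 h1.le

theorem card_level_mul_levelDensity (S : Set (Submodule (ZMod 2) V)) {k : ℕ}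
    (hk : k ≤ finrank (ZMod 2) V) :
    #(level V k) * levelDensity S k = #{A ∈ level V k | A ∈ S} :=
  mul_div_cancel₀ _ (card_level_pos hk).ne'

/-- The indicator of `S` on a level, centred to have mean zero there. -/
noncomputable def centredIndicator (S : Set (Submodule (ZMod 2) V)) (k : ℕ)
    (A : Submodule (ZMod 2) V) : ℝ :=
  if A ∈ level V k then (if A ∈ S then 1 else 0) - levelDensity S k else 0

theorem sum_level_indicator (S : Set (Submodule (ZMod 2) V)) {k : ℕ}
    (hk : k ≤ finrank (ZMod 2) V) :
    ∑ A ∈ level V k, (if A ∈ S then (1 : ℝ) else 0) = #(level V k) * levelDensity S k := by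
  rw [card_level_mul_levelDensity S hk]
  simp

theorem sum_centredIndicator (S : Set (Submodule (ZMod 2) V)) {k : ℕ}
    (hk : k ≤ finrank (ZMod 2) V) : ∑ A, centredIndicator S k A = 0 := by
  simp only [centredIndicator, sum_ite_mem, univ_inter, sum_sub_distrib]
  rw [sum_level_indicator S hk, sum_const, nsmul_eq_mul, sub_self]

theorem sum_centredIndicator_sq (S : Set (Submodule (ZMod 2) V)) {k : ℕ}
    (hk : k ≤ finrank (ZMod 2) V) :
    ∑ A, centredIndicator S k A ^ 2 =
      #(level V k) * (levelDensity S k * (1 - levelDensity S k)) := by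
  set p := levelDensity S k with hp
  have : ∀ A, centredIndicator S k A ^ 2 = if A ∈ level V k then
      (if A ∈ S then 1 else 0) * (1 - 2 * p) + p ^ 2 else 0 := by
    intro A
    unfold centredIndicator
    split_ifs <;> ring
  simp only [this, sum_ite_mem, univ_inter, sum_add_distrib, ← sum_mul]
  rw [sum_level_indicator S hk, sum_const, nsmul_eq_mul]
  ring

/-- The odds that a random subspace of dimension `k` lies in a fixed ideal at least halve when `k`
grows by one. All lower covers of a member of the ideal are members, so the sum over lower covers
maps the centred indicator on level `k` to a function that is large on the ideal in level `k + 1`;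
the spectral gap bounds its norm. -/
theorem levelDensity_succ_odds_le {Q : Set (Submodule (ZMod 2) V)} (hQ : IsLowerSet Q) {k : ℕ}
    (hk : k + 1 ≤ finrank (ZMod 2) V) :
    levelDensity Q (k + 1) * (1 - levelDensity Q k) ≤
      1 / 2 * (levelDensity Q k * (1 - levelDensity Q (k + 1))) := by
  have hk' : k ≤ finrank (ZMod 2) V := by omega
  obtain ⟨d, hd⟩ : ∃ d, k + d + 1 = finrank (ZMod 2) V :=
    ⟨finrank (ZMod 2) V - (k + 1), by omega⟩
  have hgap := sum_lowerCoverSum_sq_le d k hd (centredIndicator Q k)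
    (fun A hA => by simp [centredIndicator, hA]) (sum_centredIndicator Q hk')
  rw [sum_centredIndicator_sq Q hk'] at hgap
  have hcs := sum_mul_sq_le_sq_mul_sq univ (lowerCoverSum (centredIndicator Q k))
    (centredIndicator Q (k + 1))
  rw [sum_centredIndicator_sq Q hk] at hcs
  have hN := card_level_succ_mul (V := V) k
  have hNpos := card_level_pos hk
  rw [show finrank (ZMod 2) V - k = d + 1 by omega] at hN
  have hp0 := levelDensity_nonneg Q k
  have hp1 := levelDensity_le_one Q k
  have hq0 := levelDensity_nonneg Q (k + 1)
  have hq1 := levelDensity_le_one Q (k + 1)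
  -- the mean of the image is zero, so centring the indicator on the upper level changes nothing
  have hmean : ∑ A ∈ level V (k + 1), lowerCoverSum (centredIndicator Q k) A = 0 := by
    have h := sum_lowerCoverSum_mul (centredIndicator Q k)
      (fun A => if A ∈ level V (k + 1) then 1 else 0)
    simp only [mul_ite, mul_one, mul_zero, sum_ite_mem, univ_inter] at h
    suffices h' : ∑ A ∈ level V (k + 1), lowerCoverSum (centredIndicator Q k) A =
        (2 ^ (d + 1) - 1) * ∑ B, centredIndicator Q k B by
      rw [h', sum_centredIndicator Q hk', mul_zero]
    rw [h, mul_sum]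
    refine sum_congr rfl fun B _ => ?_
    by_cases hB : B ∈ level V k
    · have : ∀ A ∈ ({A | B ⋖ A} : Finset (Submodule (ZMod 2) V)),
          (if A ∈ level V (k + 1) then (1 : ℝ) else 0) = 1 := by
        intro A hA
        have hA' : B ⋖ A := by simpa using hA
        simp [(Submodule.covBy_iff_finrank.1 hA').2, mem_level.1 hB]
      rw [upperCoverSum, sum_congr rfl this, sum_const, nsmul_one,
        Submodule.card_upper_covers_real, mem_level.1 hB, mul_comm]
      congr 3
      omega
    · simp [centredIndicator, mem_level.not.1 hB]
  have hinner : ∑ A, lowerCoverSum (centredIndicator Q k) A * centredIndicator Q (k + 1) A =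
      #(level V (k + 1)) * levelDensity Q (k + 1) *
        ((2 ^ (k + 1) - 1) * (1 - levelDensity Q k)) := by
    have h1 : ∀ A, lowerCoverSum (centredIndicator Q k) A * centredIndicator Q (k + 1) A =
        if A ∈ level V (k + 1) then
          (if A ∈ Q then (1 : ℝ) else 0) * ((2 ^ (k + 1) - 1) * (1 - levelDensity Q k)) -
            lowerCoverSum (centredIndicator Q k) A * levelDensity Q (k + 1) else 0 := by
      intro A
      by_cases hA : A ∈ level V (k + 1)
      · rw [if_pos hA, centredIndicator, if_pos hA, mul_sub, sub_left_inj]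
        by_cases hAQ : A ∈ Q
        · have h2 : ∀ B ∈ ({B | B ⋖ A} : Finset (Submodule (ZMod 2) V)),
              centredIndicator Q k B = 1 - levelDensity Q k := by
            intro B hB
            have hB' : B ⋖ A := by simpa using hB
            have h3 : finrank (ZMod 2) B = k := by
              have := (Submodule.covBy_iff_finrank.1 hB').2
              rw [mem_level.1 hA] at this
              omega
            rw [centredIndicator, if_pos (mem_level.2 h3), if_pos (hQ hB'.le hAQ)]
          rw [if_pos hAQ, mul_one, one_mul, lowerCoverSum, sum_congr rfl h2, sum_const,
            nsmul_eq_mul, Submodule.card_lower_covers_real, mem_level.1 hA]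
        · simp [hAQ]
      · simp [centredIndicator, mem_level.not.1 hA]
    simp only [h1, sum_ite_mem, univ_inter, sum_sub_distrib, ← sum_mul]
    rw [hmean, sum_level_indicator Q hk]
    ring
  rw [hinner] at hcs
  generalize levelDensity Q k = p at *
  generalize levelDensity Q (k + 1) = q at *
  generalize (#(level V (k + 1)) : ℝ) = N' at *
  generalize (#(level V k) : ℝ) = N at *
  have hx : (1 : ℝ) ≤ 2 ^ k := one_le_pow₀ one_le_two
  have hy : (1 : ℝ) ≤ 2 ^ d := one_le_pow₀ one_le_two
  rw [pow_succ (2 : ℝ) k] at hcs hN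
  rw [pow_succ (2 : ℝ) d] at hgap hN
  generalize (2 : ℝ) ^ k = x at *
  generalize (2 : ℝ) ^ d = y at *
  have hb : 0 < x * 2 - 1 := by linarith
  have hpp : 0 ≤ p * (1 - p) := mul_nonneg hp0 (by linarith)
  have hqq : 0 ≤ q * (1 - q) := mul_nonneg hq0 (by linarith)
  have hN0 : 0 ≤ N := by
    have : 0 < (y * 2 - 1) * N := hN ▸ mul_pos hb hNpos
    exact (pos_of_mul_pos_right this (by linarith)).le
  have hgap' : (y * 2 - 2) * (x - 1) * (N * (p * (1 - p))) ≤
      1 / 2 * (x * 2 - 1) * ((y * 2 - 1) * N) * (p * (1 - p)) := by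
    have h1 : (y * 2 - 2) * (x - 1) ≤ 1 / 2 * (x * 2 - 1) * (y * 2 - 1) := by nlinarith
    calc _ ≤ 1 / 2 * (x * 2 - 1) * (y * 2 - 1) * (N * (p * (1 - p))) :=
          mul_le_mul_of_nonneg_right h1 (mul_nonneg hN0 hpp)
      _ = _ := by ring
  have hsq := hcs.trans (mul_le_mul_of_nonneg_right (hgap.trans hgap')
    (mul_nonneg hNpos.le hqq))
  rw [← hN] at hsq
  have hpos : 0 < (N' * (x * 2 - 1)) ^ 2 := by positivity
  have hprod : (q * (1 - p)) * (q * (1 - p)) ≤ (q * (1 - p)) * (1 / 2 * (p * (1 - q))) := by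
    refine le_of_mul_le_mul_left ?_ hpos
    calc _ = (N' * q * ((x * 2 - 1) * (1 - p))) ^ 2 := by ring
      _ ≤ _ := hsq
      _ = _ := by ring
  rcases (mul_nonneg hq0 (sub_nonneg.2 hp1)).eq_or_lt with h | h
  · rw [← h]
    exact mul_nonneg (by norm_num) (mul_nonneg hp0 (by linarith))
  · exact le_of_mul_le_mul_left hprod h

/-- The probability that a random subspace of dimension `k` contains a fixed nonzero vector. -/
theorem levelDensity_mem {v : V} (hv : v ≠ 0) : ∀ {k : ℕ}, k ≤ finrank (ZMod 2) V →
    (2 ^ finrank (ZMod 2) V - 1) * levelDensity {A : Submodule (ZMod 2) V | v ∈ A} k = 2 ^ k - 1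
  | 0, hk => by
    have : ({A ∈ level V 0 | A ∈ {A : Submodule (ZMod 2) V | v ∈ A}}) = ∅ := by
      ext A
      simp +contextual [hv]
    rw [levelDensity, this]
    simp
  | k + 1, hk => by
    have hk' : k ≤ finrank (ZMod 2) V := by omega
    have ih := levelDensity_mem hv hk'
    set S := {A : Submodule (ZMod 2) V | v ∈ A} with hS
    have hdc := mul_sum_level_succ (V := V) (fun A => if A ∈ S then 1 else 0) k
    rw [sum_level_indicator S hk] at hdc
    -- all upper covers of `B` contain `v` if `B` does, and exactly one does otherwise
    have hup : ∀ B ∈ level V k, upperCoverSum (fun A => if A ∈ S then 1 else 0) B =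
        1 + (if B ∈ S then 1 else 0) * (2 ^ (finrank (ZMod 2) V - k) - 2) := by
      intro B hB
      by_cases hBv : B ∈ S
      · have : ∀ A ∈ ({A | B ⋖ A} : Finset (Submodule (ZMod 2) V)),
            (if A ∈ S then (1 : ℝ) else 0) = 1 := by
          intro A hA
          have hA' : B ⋖ A := by simpa using hA
          exact if_pos (hA'.le hBv)
        rw [upperCoverSum, sum_congr rfl this, sum_const, nsmul_one,
          Submodule.card_upper_covers_real, mem_level.1 hB, if_pos hBv]
        ring
      · have hcov : B ⋖ B ⊔ (ZMod 2) ∙ v := by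
          rw [sup_comm]
          exact Submodule.covBy_span_singleton_sup hBv
        rw [if_neg hBv, zero_mul, add_zero, upperCoverSum,
          sum_eq_single (B ⊔ (ZMod 2) ∙ v)]
        · exact if_pos ((Submodule.sup_span_singleton_eq_iff_of_covBy hcov hBv).1 rfl)
        · intro A hA hne
          have hA' : B ⋖ A := by simpa using hA
          refine if_neg fun hAv => hne ?_
          exact ((Submodule.sup_span_singleton_eq_iff_of_covBy hA' hBv).2 hAv).symm
        · intro h
          exact absurd (by simpa using hcov) h
    rw [sum_congr rfl hup, sum_add_distrib, ← sum_mul, sum_level_indicator S hk', sum_const,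
      nsmul_one] at hdc
    have hN := card_level_succ_mul (V := V) k
    have hNpos := card_level_pos hk'
    obtain ⟨d, hd⟩ : ∃ d, finrank (ZMod 2) V = k + (d + 1) :=
      ⟨finrank (ZMod 2) V - (k + 1), by omega⟩
    rw [hd, Nat.add_sub_cancel_left] at hdc hN
    rw [hd] at ih ⊢
    generalize levelDensity S k = p at *
    generalize levelDensity S (k + 1) = q at *
    generalize (#(level V (k + 1)) : ℝ) = N' at *
    generalize (#(level V k) : ℝ) = N at *
    have hy : (1 : ℝ) ≤ 2 ^ d := one_le_pow₀ one_le_two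
    have h1 : N * ((2 ^ (d + 1) - 1) * q) = N * (1 + p * (2 ^ (d + 1) - 2)) := by
      linear_combination hdc - q * hN
    have h2 := mul_left_cancel₀ hNpos.ne' h1
    have h3 : (2 : ℝ) ^ (d + 1) - 1 ≠ 0 := by
      rw [pow_succ]
      linarith
    refine mul_left_cancel₀ h3 ?_
    rw [pow_add] at ih ⊢
    rw [pow_succ 2 k]
    linear_combination (2 ^ k * 2 ^ (d + 1) - 1) * h2 + (2 ^ (d + 1) - 2) * ih

theorem levelDensity_mem_le {v : V} (hv : v ≠ 0) {k : ℕ} (hk : k ≤ finrank (ZMod 2) V) :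
    levelDensity {A : Submodule (ZMod 2) V | v ∈ A} k ≤ 2 ^ k / 2 ^ finrank (ZMod 2) V := by
  have h := levelDensity_mem hv hk
  have h1 := levelDensity_le_one {A : Submodule (ZMod 2) V | v ∈ A} k
  rw [le_div_iff₀ (by positivity)]
  linarith

end Level

/-! ### Thresholds -/

section Threshold

/-- The distance of `k` from a threshold lying between `t - 1` and `t`; both of these integers have
distance `0`. -/
def thresholdDist (t k : ℕ) : ℕ := if k < t then t - 1 - k else k - t

/-- If the odds of `p` at least halve at each step, then `p` is close to `1` before some threshold
and close to `0` from there on, up to an error that is exponentially small in the distance. -/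
theorem exists_threshold {n : ℕ} {p : ℕ → ℝ} (h0 : ∀ k, 0 ≤ p k) (h1 : ∀ k, p k ≤ 1)
    (h : ∀ k, k + 1 ≤ n → p (k + 1) * (1 - p k) ≤ 1 / 2 * (p k * (1 - p (k + 1)))) :
    ∃ t, ∀ k ≤ n, (if k < t then 1 - p k else p k) ≤ (1 / 2) ^ thresholdDist t k := by
  -- the threshold is the first index with odds at most one, or `n + 1` if there is none up to `n`
  have hex : ∃ t, n < t ∨ p t ≤ 1 / 2 := ⟨n + 1, Or.inl (Nat.lt_succ_self n)⟩
  have hspec := Nat.find_spec hex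
  have hmin : ∀ k, k < Nat.find hex → 1 / 2 < p k := fun k hk =>
    not_le.1 (not_or.1 (Nat.find_min hex hk)).2
  have htn : Nat.find hex ≤ n + 1 := Nat.find_min' hex (Or.inl (Nat.lt_succ_self n))
  generalize Nat.find hex = t at hspec hmin htn
  have hup : ∀ j, t + j ≤ n → p (t + j) ≤ (1 / 2) ^ j * (1 - p (t + j)) := by
    intro j
    induction j with
    | zero =>
      intro hj
      have : p t ≤ 1 / 2 := hspec.resolve_left (by omega)
      simp only [add_zero, pow_zero, one_mul]
      linarith
    | succ j ih =>
      intro hj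
      have ih := ih (by omega)
      have hs := h (t + j) (by omega)
      rw [← add_assoc]
      have hq := h1 (t + j + 1)
      have hpow : (0 : ℝ) < (1 / 2) ^ j := by positivity
      have hlt : 0 < 1 - p (t + j) := by
        rcases (sub_nonneg.2 (h1 (t + j))).eq_or_lt with h' | h'
        · rw [← h'] at ih
          linarith
        · exact h'
      refine le_of_mul_le_mul_right ?_ hlt
      have := mul_le_mul_of_nonneg_right ih (sub_nonneg.2 hq)
      rw [pow_succ]
      linarith
  have hdown : ∀ j k, k + j + 1 = t → k ≤ n → 1 - p k ≤ (1 / 2) ^ j * p k := by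
    intro j
    induction j with
    | zero =>
      intro k hk _
      have := hmin k (by omega)
      rw [pow_zero, one_mul]
      linarith
    | succ j ih =>
      intro k hk hkn
      have hkn' : k + 1 ≤ n := by omega
      have ih := ih (k + 1) (by omega) hkn'
      have hs := h k hkn'
      have hpos : 0 < p (k + 1) := by
        have := hmin (k + 1) (by omega)
        linarith
      refine le_of_mul_le_mul_right ?_ hpos
      have := mul_le_mul_of_nonneg_right ih (h0 k)
      rw [pow_succ]
      linarith
  refine ⟨t, fun k hk => ?_⟩
  unfold thresholdDist
  split_ifs with hkt
  · refine (hdown (t - 1 - k) k (by omega) hk).trans ?_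
    exact mul_le_of_le_one_right (by positivity) (h1 k)
  · have := hup (k - t) (by omega)
    rw [show t + (k - t) = k by omega] at this
    refine this.trans (mul_le_of_le_one_right (by positivity) ?_)
    linarith [h0 k]

theorem sum_range_add_two_mul_half_pow (N : ℕ) :
    ∑ j ∈ range N, ((j : ℝ) + 2) * (1 / 2) ^ j = 6 - (2 * N + 6) * (1 / 2) ^ N := by
  induction N with
  | zero => norm_num
  | succ N ih =>
    rw [sum_range_succ, ih, pow_succ]
    push_cast
    ring

theorem sum_thresholdDist_le (t N : ℕ) :
    ∑ k ∈ range N, ((thresholdDist t k : ℝ) + 2) * (1 / 2) ^ thresholdDist t k ≤ 12 := by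
  have h6 : ∀ M, ∑ j ∈ range M, ((j : ℝ) + 2) * (1 / 2) ^ j ≤ 6 := by
    intro M
    rw [sum_range_add_two_mul_half_pow]
    have : (0 : ℝ) ≤ (2 * M + 6) * (1 / 2) ^ M := by positivity
    linarith
  have hle : ∑ k ∈ range N, ((thresholdDist t k : ℝ) + 2) * (1 / 2) ^ thresholdDist t k ≤
      ∑ k ∈ range (t + N), ((thresholdDist t k : ℝ) + 2) * (1 / 2) ^ thresholdDist t k :=
    sum_le_sum_of_subset_of_nonneg (range_mono (by omega)) fun _ _ _ => by positivity
  refine hle.trans ?_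
  rw [sum_range_add]
  have ha : ∑ k ∈ range t, ((thresholdDist t k : ℝ) + 2) * (1 / 2) ^ thresholdDist t k =
      ∑ j ∈ range t, ((j : ℝ) + 2) * (1 / 2) ^ j := by
    rw [← sum_range_reflect]
    refine sum_congr rfl fun k hk => ?_
    have hk' := mem_range.1 hk
    have : thresholdDist t (t - 1 - k) = k := by
      unfold thresholdDist
      split_ifs <;> omega
    rw [this]
  have hb : ∀ k, thresholdDist t (t + k) = k := by
    intro k
    unfold thresholdDist
    split_ifs <;> omega
  rw [ha]
  simp only [hb]
  linarith [h6 t, h6 N]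

end Threshold

/-! ### The cost of answers -/

section Coding

/-- The length of the codeword for the answer `b` to a query with threshold `t` on subspaces of
dimension `k`. The expected answer is cheap, and the unexpected one costs its surprise. -/
noncomputable def answerCost (t k : ℕ) (b : Bool) : ℝ :=
  if b = decide (k < t) then (1 / 2) ^ thresholdDist t k else thresholdDist t k + 1

theorem answerCost_nonneg (t k : ℕ) (b : Bool) : 0 ≤ answerCost t k b := by
  unfold answerCost
  split_ifs <;> positivity

/-- Kraft's inequality for the answers to one query. -/
theorem sum_half_rpow_answerCost_le_one (t k : ℕ) :
    ∑ b, (1 / 2 : ℝ) ^ answerCost t k b ≤ 1 := by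
  have key : (1 / 2 : ℝ) ^ ((1 / 2 : ℝ) ^ thresholdDist t k) +
      (1 / 2 : ℝ) ^ ((thresholdDist t k : ℝ) + 1) ≤ 1 := by
    have hx0 : (0 : ℝ) ≤ (1 / 2) ^ thresholdDist t k := by positivity
    have hx1 : (1 / 2 : ℝ) ^ thresholdDist t k ≤ 1 := pow_le_one₀ (by norm_num) (by norm_num)
    -- Bernoulli's inequality `(1 / 2) ^ x ≤ 1 - x / 2` for the length `x` of the expected answer
    have h1 := rpow_one_add_le_one_add_mul_self (s := -1 / 2) (by norm_num) hx0 hx1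
    rw [show (1 : ℝ) + -1 / 2 = 1 / 2 by norm_num] at h1
    have h2 : (1 / 2 : ℝ) ^ ((thresholdDist t k : ℝ) + 1) = (1 / 2) ^ thresholdDist t k / 2 := by
      rw [Real.rpow_add (by norm_num), Real.rpow_natCast, Real.rpow_one]
      ring
    linarith
  rw [Fintype.sum_bool]
  unfold answerCost
  by_cases h : k < t
  · simpa [h] using key
  · simpa [h, add_comm] using key

/-- By Kraft's inequality, few answer vectors have a short code. -/
theorem card_sum_answerCost_le {m : ℕ} (t : Fin m → ℕ) (k : ℕ) (W : ℝ) :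
    (#{a : Fin m → Bool | ∑ i, answerCost (t i) k (a i) ≤ W} : ℝ) ≤ 2 ^ W := by
  have hkraft : ∑ a : Fin m → Bool, (1 / 2 : ℝ) ^ ∑ i, answerCost (t i) k (a i) ≤ 1 := by
    have : ∀ a : Fin m → Bool, (1 / 2 : ℝ) ^ ∑ i, answerCost (t i) k (a i) =
        ∏ i, (1 / 2 : ℝ) ^ answerCost (t i) k (a i) := fun a =>
      Real.rpow_sum_of_pos (by norm_num) _ _
    simp only [this]
    have hprod := prod_univ_sum (t := fun _ : Fin m => (univ : Finset Bool))
      (f := fun i b => (1 / 2 : ℝ) ^ answerCost (t i) k b)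
    rw [Fintype.piFinset_univ] at hprod
    rw [← hprod]
    exact prod_le_one (fun i _ => sum_nonneg fun b _ => by positivity)
      fun i _ => sum_half_rpow_answerCost_le_one (t i) k
  have hle : (#{a : Fin m → Bool | ∑ i, answerCost (t i) k (a i) ≤ W} : ℝ) * (1 / 2) ^ W ≤ 1 := by
    refine le_trans ?_ hkraft
    rw [← nsmul_eq_mul]
    refine (card_nsmul_le_sum _ _ _ fun a ha => ?_).trans
      (sum_le_sum_of_subset_of_nonneg (filter_subset _ _) fun _ _ _ => by positivity)
    exact Real.rpow_le_rpow_of_exponent_ge (by norm_num) (by norm_num) (by simpa using ha)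
  rwa [one_div, Real.inv_rpow (by norm_num), ← div_eq_mul_inv, div_le_one (by positivity)] at hle

end Coding

/-! ### Decoding a random subspace -/

section Decoder

variable {n m : ℕ}

theorem successProb_toReal (P : PMF (Fin m → SubspaceIdeal n)) [Fintype (Fin m → SubspaceIdeal n)]
    (f : (Fin m → Bool) → {v : F2Vec n // v ≠ 0}) (A : SubspaceLattice n) :
    (successProb P f A).toReal =
      ∑ Q, (P Q).toReal * (if (f (queryAnswers Q A) : F2Vec n) ∈ A then 1 else 0) := by
  rw [successProb, PMF.toOuterMeasure_apply, tsum_fintype, ENNReal.toReal_sum]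
  · refine sum_congr rfl fun Q _ => ?_
    by_cases h : (f (queryAnswers Q A) : F2Vec n) ∈ A <;> simp [Set.indicator, h]
  · intro Q _
    exact ((Set.indicator_le_self _ _ _).trans_lt (P.apply_lt_top Q)).ne

/-- Without queries the guess is a fixed vector, which some line avoids. -/
theorem queries_ne_zero (hn : 2 ≤ n) (P : PMF (Fin m → SubspaceIdeal n))
    (f : (Fin m → Bool) → {v : F2Vec n // v ≠ 0})
    (h : ∀ A : SubspaceLattice n, A ≠ ⊥ → (1 / 2 : ENNReal) ≤ successProb P f A) : m ≠ 0 := by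
  rintro rfl
  obtain ⟨v, hv⟩ : ∃ v, ∀ a, f a = v := ⟨f 0, fun a => congrArg f (Subsingleton.elim _ _)⟩
  obtain ⟨w, hw⟩ : ∃ w : F2Vec n, w ∉ ({0, v.1} : Finset (F2Vec n)) := by
    by_contra! hall
    have h1 := card_le_card (fun w _ => hall w : (univ : Finset (F2Vec n)) ⊆ {0, v.1})
    have h2 : 2 ^ 2 ≤ 2 ^ n := Nat.pow_le_pow_right two_pos hn
    have h3 := card_le_two (a := 0) (b := v.1)
    rw [card_univ, Fintype.card_fun, ZMod.card, Fintype.card_fin] at h1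
    omega
  rw [mem_insert, mem_singleton, not_or] at hw
  have hvw : v.1 ∉ (ZMod 2) ∙ w := by
    rw [Submodule.mem_span_singleton]
    rintro ⟨a, ha⟩
    have hbit : ∀ b : ZMod 2, b = 0 ∨ b = 1 := by decide
    rcases hbit a with rfl | rfl
    · exact v.2 (by rw [← ha, zero_smul])
    · exact hw.2 (by rw [← ha, one_smul])
  have := h ((ZMod 2) ∙ w) (by simpa using hw.1)
  simp [successProb, hv, hvw] at this

variable [Fintype (SubspaceLattice n)]

theorem finrank_F2Vec (n : ℕ) : finrank (ZMod 2) (F2Vec n) = n := by simp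

/-- The ideal `Q` has threshold `t`: on subspaces of dimension `k`, membership in `Q` agrees with
`k < t` except with probability exponentially small in the distance from `k` to `t`. -/
def HasThreshold (Q : SubspaceIdeal n) (t : ℕ) : Prop :=
  ∀ k ≤ n, (if k < t then 1 - levelDensity (Q : Set (SubspaceLattice n)) k
    else levelDensity (Q : Set (SubspaceLattice n)) k) ≤ (1 / 2) ^ thresholdDist t k

theorem exists_hasThreshold (Q : SubspaceIdeal n) : ∃ t, HasThreshold Q t :=
  exists_threshold (levelDensity_nonneg _) (levelDensity_le_one _) fun _ hk =>
    levelDensity_succ_odds_le Q.lower (by rwa [finrank_F2Vec])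

/-- The expected cost of the answer to a query is bounded in terms of the distance to its
threshold. -/
theorem sum_answerCost_le {Q : SubspaceIdeal n} {t : ℕ} (ht : HasThreshold Q t) {k : ℕ}
    (hk : k ≤ n) :
    ∑ A ∈ level (F2Vec n) k, answerCost t k (decide (A ∈ Q)) ≤
      #(level (F2Vec n) k) * (((thresholdDist t k : ℝ) + 2) * (1 / 2) ^ thresholdDist t k) := by
  have hk' : k ≤ finrank (ZMod 2) (F2Vec n) := by rwa [finrank_F2Vec]
  have hN := card_level_pos hk'
  set j := thresholdDist t k with hj
  have h1 : ∀ A : SubspaceLattice n, answerCost t k (decide (A ∈ Q)) ≤ (1 / 2) ^ j +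
      (j + 1) * (if k < t then 1 - (if A ∈ (Q : Set (SubspaceLattice n)) then 1 else 0)
        else (if A ∈ (Q : Set (SubspaceLattice n)) then 1 else 0)) := by
    intro A
    have hp : (0 : ℝ) ≤ (1 / 2) ^ j := by positivity
    by_cases h : k < t <;> by_cases hA : A ∈ Q <;> simp [answerCost, h, hA, ← hj]
  refine (sum_le_sum fun A _ => h1 A).trans ?_
  have h2 : ∑ A ∈ level (F2Vec n) k,
      (if k < t then 1 - (if A ∈ (Q : Set (SubspaceLattice n)) then (1 : ℝ) else 0)
        else (if A ∈ (Q : Set (SubspaceLattice n)) then 1 else 0)) =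
      #(level (F2Vec n) k) * (if k < t then 1 - levelDensity (Q : Set (SubspaceLattice n)) k
        else levelDensity (Q : Set (SubspaceLattice n)) k) := by
    split_ifs with h
    · rw [sum_sub_distrib, sum_level_indicator _ hk', sum_const, nsmul_one]
      ring
    · rw [sum_level_indicator _ hk']
  rw [sum_add_distrib, ← mul_sum, h2, sum_const, nsmul_eq_mul]
  have h3 := ht k hk
  have hj0 : (0 : ℝ) ≤ (j : ℝ) + 1 := by positivity
  have := mul_le_mul_of_nonneg_left (mul_le_mul_of_nonneg_left h3 hN.le) hj0
  linarith

/-- For fixed queries, the decoder succeeds on a random subspace of dimension `k` only if the answers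
have a long code, or if it guesses a vector of the subspace from one of few answer vectors. -/
theorem levelDensity_success_le (Q : Fin m → SubspaceIdeal n)
    (f : (Fin m → Bool) → {v : F2Vec n // v ≠ 0}) {t : Fin m → ℕ}
    (ht : ∀ i, HasThreshold (Q i) (t i)) {k : ℕ} (hk : k ≤ n) {W : ℝ} (hW : 0 < W) :
    levelDensity {A : SubspaceLattice n | (f (queryAnswers Q A) : F2Vec n) ∈ A} k ≤
      (∑ i, ((thresholdDist (t i) k : ℝ) + 2) * (1 / 2) ^ thresholdDist (t i) k) / W +
        2 ^ W * (2 ^ k / 2 ^ n) := by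
  have hk' : k ≤ finrank (ZMod 2) (F2Vec n) := by rwa [finrank_F2Vec]
  have hN := card_level_pos hk'
  set N : ℝ := (#(level (F2Vec n) k) : ℝ)
  set w : (Fin m → Bool) → ℝ := fun a => ∑ i, answerCost (t i) k (a i) with hw
  have hw0 : ∀ a, 0 ≤ w a := fun a => sum_nonneg fun i _ => answerCost_nonneg _ _ _
  set short : Finset (Fin m → Bool) := {a | w a ≤ W} with hshort
  -- Markov's inequality for the code length
  have hlong : (#{A ∈ level (F2Vec n) k | W < w (queryAnswers Q A)} : ℝ) * W ≤
      N * ∑ i, ((thresholdDist (t i) k : ℝ) + 2) * (1 / 2) ^ thresholdDist (t i) k := by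
    rw [← nsmul_eq_mul]
    refine (card_nsmul_le_sum _ (fun A => w (queryAnswers Q A)) _ fun A hA =>
      (mem_filter.1 hA).2.le).trans ?_
    refine (sum_le_sum_of_subset_of_nonneg (filter_subset _ _) fun _ _ _ => hw0 _).trans ?_
    rw [hw, sum_comm, mul_sum]
    exact sum_le_sum fun i _ => sum_answerCost_le (ht i) hk
  have hguess : ∀ a ∈ short, (#{A ∈ level (F2Vec n) k | (f a : F2Vec n) ∈ A} : ℝ) ≤
      N * (2 ^ k / 2 ^ n) := by
    intro a _
    have h := levelDensity_mem_le (f a).2 hk'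
    rw [finrank_F2Vec] at h
    calc _ = N * levelDensity {A : SubspaceLattice n | (f a : F2Vec n) ∈ A} k := by
          rw [card_level_mul_levelDensity _ hk']
          rfl
      _ ≤ _ := mul_le_mul_of_nonneg_left h hN.le
  have hcover : ({A ∈ level (F2Vec n) k |
        A ∈ {A : SubspaceLattice n | (f (queryAnswers Q A) : F2Vec n) ∈ A}}) ⊆
      ({A ∈ level (F2Vec n) k | W < w (queryAnswers Q A)}) ∪
        short.biUnion fun a => {A ∈ level (F2Vec n) k | (f a : F2Vec n) ∈ A} := by
    intro A hA
    obtain ⟨hA1, hA2⟩ := mem_filter.1 hA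
    rw [mem_union, mem_biUnion]
    rcases lt_or_ge W (w (queryAnswers Q A)) with h | h
    · exact Or.inl (mem_filter.2 ⟨hA1, h⟩)
    · exact Or.inr ⟨queryAnswers Q A, by simpa [hshort] using h, mem_filter.2 ⟨hA1, hA2⟩⟩
  have hcard : (#{A ∈ level (F2Vec n) k |
        A ∈ {A : SubspaceLattice n | (f (queryAnswers Q A) : F2Vec n) ∈ A}} : ℝ) ≤
      #{A ∈ level (F2Vec n) k | W < w (queryAnswers Q A)} + 2 ^ W * (N * (2 ^ k / 2 ^ n)) := by
    have h1 := (card_le_card hcover).trans ((card_union_le _ _).trans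
      (Nat.add_le_add_left card_biUnion_le _))
    refine (Nat.cast_le (α := ℝ).2 h1).trans ?_
    push_cast
    refine add_le_add_right ((sum_le_card_nsmul _ _ _ hguess).trans ?_) _
    rw [nsmul_eq_mul]
    exact mul_le_mul_of_nonneg_right (card_sum_answerCost_le t k W) (by positivity)
  rw [levelDensity, div_le_iff₀ hN]
  refine hcard.trans ?_
  have h4 := (le_div_iff₀ hW).2 hlong
  calc _ ≤ _ := add_le_add_left h4 _
    _ = _ := by ring

/-- Summed over the dimensions up to `n / 2`, the success probabilities of a decoder with fixed
queries are small unless there are many queries. -/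
theorem sum_levelDensity_success_le (hn : 16 ≤ n) (Q : Fin m → SubspaceIdeal n)
    (f : (Fin m → Bool) → {v : F2Vec n // v ≠ 0}) :
    ∑ k ∈ Icc 1 (n / 2),
        levelDensity {A : SubspaceLattice n | (f (queryAnswers Q A) : F2Vec n) ∈ A} k ≤
      48 * m / n + (n / 2 : ℕ) / 16 := by
  choose t ht using fun i => exists_hasThreshold (Q i)
  have hn0 : (16 : ℝ) ≤ n := by exact_mod_cast hn
  have hW : (0 : ℝ) < n / 4 := by linarith
  have hterm : ∀ k ∈ Icc 1 (n / 2),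
      levelDensity {A : SubspaceLattice n | (f (queryAnswers Q A) : F2Vec n) ∈ A} k ≤
        (∑ i, ((thresholdDist (t i) k : ℝ) + 2) * (1 / 2) ^ thresholdDist (t i) k) / (n / 4) +
          1 / 16 := by
    intro k hk
    have hk2 := (mem_Icc.1 hk).2
    refine (levelDensity_success_le Q f ht (by omega) hW).trans (add_le_add_right ?_ _)
    have hk3 : (k : ℝ) ≤ n / 2 := by
      rw [le_div_iff₀ two_pos]
      exact_mod_cast (by omega : k * 2 ≤ n)
    rw [← Real.rpow_natCast, ← Real.rpow_natCast, ← Real.rpow_sub two_pos,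
      ← Real.rpow_add two_pos]
    calc (2 : ℝ) ^ ((n : ℝ) / 4 + (k - n)) ≤ 2 ^ (-4 : ℝ) :=
          Real.rpow_le_rpow_of_exponent_le one_le_two (by linarith)
      _ = 1 / 16 := by
        rw [Real.rpow_neg two_pos.le]
        norm_num
  refine (sum_le_sum hterm).trans ?_
  rw [sum_add_distrib, ← sum_div, sum_comm, sum_const, Nat.card_Icc, nsmul_eq_mul,
    Nat.add_sub_cancel]
  have hq : ∀ i, ∑ k ∈ Icc 1 (n / 2),
      ((thresholdDist (t i) k : ℝ) + 2) * (1 / 2) ^ thresholdDist (t i) k ≤ 12 := fun i =>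
    (sum_le_sum_of_subset_of_nonneg (fun k hk => mem_range.2 (by
      have := (mem_Icc.1 hk).2
      omega)) fun _ _ _ => by positivity).trans (sum_thresholdDist_le (t i) (n / 2 + 1))
  have hsum := sum_le_card_nsmul univ _ _ fun i _ => hq i
  rw [card_univ, Fintype.card_fin, nsmul_eq_mul] at hsum
  have h5 := div_le_div_of_nonneg_right hsum hW.le
  have h6 : (m : ℝ) * 12 / (n / 4) = 48 * m / n := by
    field_simp
    ring
  linarith

/-- Averaging over the queries: a decoder that succeeds with probability `1 / 2` on every nonzero
subspace does so on average over each level, for queries drawn from `P`. -/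
theorem half_le_sum_levelDensity (P : PMF (Fin m → SubspaceIdeal n))
    [Fintype (Fin m → SubspaceIdeal n)] (f : (Fin m → Bool) → {v : F2Vec n // v ≠ 0})
    (h : ∀ A : SubspaceLattice n, A ≠ ⊥ → (1 / 2 : ENNReal) ≤ successProb P f A)
    {k : ℕ} (hk0 : 1 ≤ k) (hk : k ≤ n) :
    1 / 2 ≤ ∑ Q, (P Q).toReal *
      levelDensity {A : SubspaceLattice n | (f (queryAnswers Q A) : F2Vec n) ∈ A} k := by
  have hk' : k ≤ finrank (ZMod 2) (F2Vec n) := by rwa [finrank_F2Vec]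
  have hN := card_level_pos hk'
  refine le_of_mul_le_mul_left ?_ hN
  have h1 : ∀ A ∈ level (F2Vec n) k, (1 / 2 : ℝ) ≤ (successProb P f A).toReal := by
    intro A hA
    have hA0 : A ≠ ⊥ := by
      rintro rfl
      rw [mem_level, finrank_bot] at hA
      omega
    have hle : successProb P f A ≤ P.toOuterMeasure Set.univ :=
      P.toOuterMeasure.mono (Set.subset_univ _)
    rw [(P.toOuterMeasure_apply_eq_one_iff _).2 (Set.subset_univ _)] at hle
    have hfin : successProb P f A ≠ ⊤ := (hle.trans_lt ENNReal.one_lt_top).ne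
    have := ENNReal.toReal_mono hfin (h A hA0)
    simpa using this
  have h2 := card_nsmul_le_sum _ _ _ h1
  rw [nsmul_eq_mul] at h2
  refine h2.trans (le_of_eq ?_)
  simp only [successProb_toReal]
  rw [sum_comm, mul_sum]
  refine sum_congr rfl fun Q _ => ?_
  rw [← mul_sum, mul_left_comm, ← sum_level_indicator _ hk']
  rfl

end Decoder

theorem mainTheorem4 :
    ∃ c : ℝ, 0 < c ∧
      ∀ (n m : ℕ), 2 ≤ n →
        ∀ (P : PMF (Fin m → SubspaceIdeal n))
          (f : (Fin m → Bool) → {v : F2Vec n // v ≠ 0}),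
          (∀ A : SubspaceLattice n, A ≠ ⊥ → (1 / 2 : ENNReal) ≤ successProb P f A) →
            c * (n : ℝ) ^ 2 ≤ (m : ℝ) := by
  refine ⟨1 / 400, by norm_num, fun n m hn P f h => ?_⟩
  have := Fintype.ofFinite (SubspaceLattice n)
  -- in small dimensions a single query is enough, since `16 ^ 2 / 400 ≤ 1`
  rcases lt_or_ge n 16 with hlt | hge
  · have hm : (1 : ℝ) ≤ m := by
      exact_mod_cast Nat.one_le_iff_ne_zero.2 (queries_ne_zero hn P f h)
    have hn' : (n : ℝ) ≤ 16 := by exact_mod_cast hlt.le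
    have : (n : ℝ) ^ 2 ≤ 16 ^ 2 := pow_le_pow_left₀ (Nat.cast_nonneg n) hn' 2
    linarith
  have : Finite (SubspaceIdeal n) := Finite.of_injective _ SetLike.coe_injective
  have := Fintype.ofFinite (Fin m → SubspaceIdeal n)
  have hP : ∑ Q, (P Q).toReal = 1 := by
    rw [← ENNReal.toReal_sum fun Q _ => P.apply_ne_top Q, ← tsum_fintype (L := .unconditional _),
      P.tsum_coe,
      ENNReal.toReal_one]
  have hlow := card_nsmul_le_sum (Icc 1 (n / 2)) _ _ fun k hk =>
    half_le_sum_levelDensity P f h (mem_Icc.1 hk).1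
      (show k ≤ n by have := (mem_Icc.1 hk).2; omega)
  rw [sum_comm, Nat.card_Icc, Nat.add_sub_cancel, nsmul_eq_mul] at hlow
  simp only [← mul_sum] at hlow
  have hup := sum_le_sum fun Q (_ : Q ∈ univ) => mul_le_mul_of_nonneg_left
    (sum_levelDensity_success_le hge Q f) (ENNReal.toReal_nonneg (a := P Q))
  rw [← sum_mul, hP, one_mul] at hup
  have hle := hlow.trans hup
  have hn0 : (16 : ℝ) ≤ n := by exact_mod_cast hge
  have hhalf : (n : ℝ) ≤ 3 * (n / 2 : ℕ) := by exact_mod_cast (by omega : n ≤ 3 * (n / 2))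
  have h48 : 7 / 48 * (n : ℝ) ≤ 48 * m / n := by linarith
  rw [le_div_iff₀ (by linarith)] at h48
  nlinarith
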